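/- Let $n\ge 2$, let $\mathbb F_{n-1}$ be the free group on $n-1$ generators, let $w_2,\dots,w_n$ be the universal unitaries that generate the full group C$^*$-algebra $C^*(\mathbb F_{n-1})$, and let $w_1=1$. Let $\mathcal W_n\subseteq C^*(\mathbb F_{n-1})$ be the operator system spanned by $\{w_iw_j^* : 1\le i,j\le n\}$, and let $\mathcal E_n\subseteq M_n(\mathbb C)$ be the operator subsystem $$\mathcal E_n=\{A=[a_{ij}]\in M_n(\mathbb C) : a_{ii}=a_{jj},\ 1\le i,j\le n\}.$$ Let $\mathcal W_n^d$ denote the dual vector space of $\mathcal W_n$ with the involution $f^*(s)=\overline{f(s^*)}$, where a matrix $G=[g_{ij}]\in M_p(\mathcal W_n^d)$ is positive if and only if the map $\mathcal W_n\to M_p(\mathbb C)$, $s\mapsto[g_{ij}(s)]$, is completely positive. A faithful state $\delta$ on $\mathcal W_n$ exists, and with any faithful state $\delta$ as Archimedean order unit $\mathcal W_n^d$ is an operator system. The operator systems $\mathcal W_n^d$ and $\mathcal E_n$ are completely order isomorphic: there is a linear isomorphism $\theta:\mathcal W_n^d\to\mathcal E_n$ such that $\theta$ and $\theta^{-1}$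 are completely positive. -/

import Mathlib

open scoped ComplexOrder ENNReal Matrix

/-- The matrix `α* x α` for a scalar matrix `α` and a matrix `x` over a complex vector space. -/
def scalarCompress {V : Type*} [AddCommGroup V] [Module ℂ V] {p q : ℕ}
    (α : Matrix (Fin p) (Fin q) ℂ) (x : Matrix (Fin p) (Fin p) V) : Matrix (Fin q) (Fin q) V :=
  Matrix.of fun i j => ∑ k, ∑ l, (star (α k i) * α l j) • x k l

/-- An (abstract) operator system on a complex `*`-vector space `V`: a matrix ordering, given by
proper cones of hermitian matrices that are compatible under compression by scalar matrices,
together with an Archimedean matrix order unit. -/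
structure OperatorSystem (V : Type*) [AddCommGroup V] [Module ℂ V] [StarAddMonoid V]
    [StarModule ℂ V] where
  /-- the positive cone `M_p(V)_+` -/
  cone : ∀ p : ℕ, Set (Matrix (Fin p) (Fin p) V)
  /-- the order unit -/
  unit : V
  isHermitian : ∀ {p : ℕ} {x : Matrix (Fin p) (Fin p) V}, x ∈ cone p → xᴴ = x
  add_mem : ∀ {p : ℕ} {x y : Matrix (Fin p) (Fin p) V}, x ∈ cone p → y ∈ cone p → x + y ∈ cone p
  smul_mem : ∀ {p : ℕ} {x : Matrix (Fin p) (Fin p) V} (r : ℝ), 0 ≤ r → x ∈ cone p →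
    (r : ℂ) • x ∈ cone p
  proper : ∀ {p : ℕ} {x : Matrix (Fin p) (Fin p) V}, x ∈ cone p → -x ∈ cone p → x = 0
  compress_mem : ∀ {p q : ℕ} (α : Matrix (Fin p) (Fin q) ℂ) {x : Matrix (Fin p) (Fin p) V},
    x ∈ cone p → scalarCompress α x ∈ cone q
  star_unit : star unit = unit
  order_unit : ∀ {p : ℕ} (x : Matrix (Fin p) (Fin p) V), xᴴ = x →
    ∃ r : ℝ, 0 ≤ r ∧ (r : ℂ) • Matrix.diagonal (fun _ => unit) + x ∈ cone p
  archimedean : ∀ {p : ℕ} (x : Matrix (Fin p) (Fin p) V),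
    (∀ ε : ℝ, 0 < ε → (ε : ℂ) • Matrix.diagonal (fun _ => unit) + x ∈ cone p) → x ∈ cone p

/-- A linear map `φ` is completely positive if every amplification `φ^(p)`, applied entrywise,
maps `M_p(V)_+` into `M_p(W)_+`. -/
def IsCompletelyPositive {V W : Type*} [AddCommGroup V] [Module ℂ V] [StarAddMonoid V]
    [StarModule ℂ V] [AddCommGroup W] [Module ℂ W] [StarAddMonoid W] [StarModule ℂ W]
    (S : OperatorSystem V) (T : OperatorSystem W) (φ : V →ₗ[ℂ] W) : Prop :=
  ∀ (p : ℕ) (x : Matrix (Fin p) (Fin p) V), x ∈ S.cone p → x.map φ ∈ T.cone p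

/-- A complete order isomorphism: a linear isomorphism that is completely positive and has a
completely positive inverse. -/
def IsCompleteOrderIso {V W : Type*} [AddCommGroup V] [Module ℂ V] [StarAddMonoid V]
    [StarModule ℂ V] [AddCommGroup W] [Module ℂ W] [StarAddMonoid W] [StarModule ℂ W]
    (S : OperatorSystem V) (T : OperatorSystem W) (φ : V ≃ₗ[ℂ] W) : Prop :=
  IsCompletelyPositive S T φ.toLinearMap ∧ IsCompletelyPositive T S φ.symm.toLinearMap

/-- Two operator systems are completely order isomorphic. -/
def CompletelyOrderIsomorphic {V W : Type*} [AddCommGroup V] [Module ℂ V] [StarAddMonoid V]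
    [StarModule ℂ V] [AddCommGroup W] [Module ℂ W] [StarAddMonoid W] [StarModule ℂ W]
    (S : OperatorSystem V) (T : OperatorSystem W) : Prop :=
  ∃ φ : V ≃ₗ[ℂ] W, IsCompleteOrderIso S T φ

/-- The cone of positive elements of the C*-algebra `M_p(A)`. -/
def cstarCone (A : Type*) [CStarAlgebra A] (p : ℕ) : Set (Matrix (Fin p) (Fin p) A) :=
  {x | ∃ y : Matrix (Fin p) (Fin p) A, x = yᴴ * y}

theorem CStarAlgebra.nonneg_iff_star_mul {B : Type*} [CStarAlgebra B] [PartialOrder B]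
    [StarOrderedRing B] (b : B) : 0 ≤ b ↔ ∃ c, b = star c * c :=
  CStarAlgebra.nonneg_iff_eq_star_mul_self

theorem mem_cstarCone_iff {A : Type*} [CStarAlgebra A] [PartialOrder A] [StarOrderedRing A]
    {p : ℕ} (x : Matrix (Fin p) (Fin p) A) :
    x ∈ cstarCone A p ↔ 0 ≤ CStarMatrix.ofMatrix x := by
  exact (CStarAlgebra.nonneg_iff_star_mul (CStarMatrix.ofMatrix x)).symm

theorem cstarCone_add_mem {A : Type*} [CStarAlgebra A] {p : ℕ} {x y : Matrix (Fin p) (Fin p) A}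
    (hx : x ∈ cstarCone A p) (hy : y ∈ cstarCone A p) : x + y ∈ cstarCone A p := by
  let _ := CStarAlgebra.spectralOrder A
  let _ := CStarAlgebra.spectralOrderedRing A
  rw [mem_cstarCone_iff] at *
  exact add_nonneg hx hy

theorem cstarCone_proper {A : Type*} [CStarAlgebra A] {p : ℕ} {x : Matrix (Fin p) (Fin p) A}
    (hx : x ∈ cstarCone A p) (hy : -x ∈ cstarCone A p) : x = 0 := by
  let _ := CStarAlgebra.spectralOrder A
  let _ := CStarAlgebra.spectralOrderedRing A
  rw [mem_cstarCone_iff] at *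
  exact le_antisymm (α := CStarMatrix (Fin p) (Fin p) A) (neg_nonneg.mp hy) hx

theorem cstarCone_smul_mem {A : Type*} [CStarAlgebra A] {p : ℕ} {x : Matrix (Fin p) (Fin p) A}
    (r : ℝ) (hr : 0 ≤ r) (hx : x ∈ cstarCone A p) : (r : ℂ) • x ∈ cstarCone A p := by
  obtain ⟨y, rfl⟩ := hx
  refine ⟨((Real.sqrt r : ℝ) : ℂ) • y, ?_⟩
  rw [Matrix.conjTranspose_smul, Matrix.smul_mul, Matrix.mul_smul, smul_smul]
  congr 1
  rw [Complex.star_def, Complex.conj_ofReal, ← Complex.ofReal_mul, Real.mul_self_sqrt hr]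

theorem cstarCone_gram_mem {A : Type*} [CStarAlgebra A] {p q : ℕ}
    (z : Matrix (Fin p) (Fin q) A) : zᴴ * z ∈ cstarCone A q := by
  rcases Nat.eq_zero_or_pos q with rfl | hq
  · exact ⟨0, Subsingleton.elim _ _⟩
  have key : zᴴ * z = ∑ k : Fin p,
      (Matrix.of fun i j => if i = (⟨0, hq⟩ : Fin q) then z k j else 0)ᴴ *
      (Matrix.of fun (i j : Fin q) => if i = (⟨0, hq⟩ : Fin q) then z k j else 0) := by
    ext i j
    simp [Matrix.mul_apply, Matrix.sum_apply, apply_ite]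
  rw [key]
  refine Finset.sum_induction _ (· ∈ cstarCone A q) (fun _ _ => cstarCone_add_mem) ⟨0, by simp⟩ ?_
  intro k _
  exact ⟨_, rfl⟩

theorem cstarCone_compress_mem {A : Type*} [CStarAlgebra A] {p q : ℕ}
    (α : Matrix (Fin p) (Fin q) ℂ) {x : Matrix (Fin p) (Fin p) A} (hx : x ∈ cstarCone A p) :
    scalarCompress α x ∈ cstarCone A q := by
  obtain ⟨y, rfl⟩ := hx
  convert cstarCone_gram_mem (y * α.map (algebraMap ℂ A)) using 1
  rw [Matrix.conjTranspose_mul, Matrix.mul_assoc, ← Matrix.mul_assoc yᴴ]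
  generalize yᴴ * y = w
  ext i j
  simp only [scalarCompress, Matrix.of_apply, Matrix.mul_apply, Matrix.conjTranspose_apply,
    Matrix.map_apply, Finset.mul_sum]
  refine Finset.sum_congr rfl fun k _ => Finset.sum_congr rfl fun l _ => ?_
  rw [← algebraMap_star_comm, ← Algebra.commutes (α l j), ← mul_assoc, ← map_mul,
    Algebra.smul_def]

theorem cstarCone_order_unit {A : Type*} [CStarAlgebra A] {p : ℕ} (x : Matrix (Fin p) (Fin p) A)
    (hx : xᴴ = x) :
    ∃ r : ℝ, 0 ≤ r ∧ (r : ℂ) • Matrix.diagonal (fun _ => (1 : A)) + x ∈ cstarCone A p := by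
  let _ := CStarAlgebra.spectralOrder A
  let _ := CStarAlgebra.spectralOrderedRing A
  let X : CStarMatrix (Fin p) (Fin p) A := CStarMatrix.ofMatrix x
  have hX : IsSelfAdjoint X := hx
  refine ⟨‖X‖, norm_nonneg _, ?_⟩
  rw [mem_cstarCone_iff]
  have h := hX.neg_algebraMap_norm_le_self
  have h2 := neg_le_iff_add_nonneg.mp h
  rw [add_comm] at h2
  convert h2 using 1
  rw [Algebra.algebraMap_eq_smul_one]
  rfl

theorem cstarCone_archimedean {A : Type*} [CStarAlgebra A] {p : ℕ} (x : Matrix (Fin p) (Fin p) A)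
    (hx : ∀ ε : ℝ, 0 < ε → (ε : ℂ) • Matrix.diagonal (fun _ => (1 : A)) + x ∈ cstarCone A p) :
    x ∈ cstarCone A p := by
  let _ := CStarAlgebra.spectralOrder A
  let _ := CStarAlgebra.spectralOrderedRing A
  rw [mem_cstarCone_iff]
  let X : CStarMatrix (Fin p) (Fin p) A := CStarMatrix.ofMatrix x
  have h : Filter.Tendsto (fun ε : ℝ => (ε : ℂ) • (1 : CStarMatrix (Fin p) (Fin p) A) + X)
      (nhdsWithin 0 (Set.Ioi 0)) (nhds X) := by
    have : Continuous fun ε : ℝ => (ε : ℂ) • (1 : CStarMatrix (Fin p) (Fin p) A) + X := by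
      fun_prop
    have h0 := this.tendsto 0
    simp only [Complex.ofReal_zero, zero_smul, zero_add] at h0
    exact h0.mono_left nhdsWithin_le_nhds
  refine ge_of_tendsto h ?_
  filter_upwards [self_mem_nhdsWithin] with ε hε
  have := hx ε hε
  rw [mem_cstarCone_iff] at this
  exact this

theorem cstarCone_isHermitian {A : Type*} [CStarAlgebra A] {p : ℕ}
    {x : Matrix (Fin p) (Fin p) A} (hx : x ∈ cstarCone A p) : xᴴ = x := by
  obtain ⟨y, rfl⟩ := hx
  simp

/-- A unital C*-algebra as an operator system. -/
def OperatorSystem.ofCStarAlgebra (A : Type*) [CStarAlgebra A] : OperatorSystem A where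
  cone := cstarCone A
  unit := 1
  isHermitian := cstarCone_isHermitian
  add_mem := cstarCone_add_mem
  smul_mem := cstarCone_smul_mem
  proper := cstarCone_proper
  compress_mem := cstarCone_compress_mem
  star_unit := star_one A
  order_unit := cstarCone_order_unit
  archimedean := cstarCone_archimedean

/-- An operator subsystem of a unital C*-algebra `A`: a linear subspace that is closed under the
involution and contains the unit. -/
structure OperatorSubsystem (A : Type*) [CStarAlgebra A] extends Submodule ℂ A where
  one_mem' : (1 : A) ∈ carrier
  star_mem' : ∀ {a : A}, a ∈ carrier → star a ∈ carrier

instance OperatorSubsystem.instSetLike (A : Type*) [CStarAlgebra A] :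
    SetLike (OperatorSubsystem A) A where
  coe U := U.carrier
  coe_injective U U' h := by
    obtain ⟨U, _, _⟩ := U
    obtain ⟨U', _, _⟩ := U'
    congr
    exact SetLike.coe_injective h

instance OperatorSubsystem.instAddSubgroupClass (A : Type*) [CStarAlgebra A] :
    AddSubgroupClass (OperatorSubsystem A) A where
  add_mem {U} _ _ := U.toSubmodule.add_mem
  zero_mem U := U.toSubmodule.zero_mem
  neg_mem {U} _ := U.toSubmodule.neg_mem

instance OperatorSubsystem.instSMulMemClass (A : Type*) [CStarAlgebra A] :
    SMulMemClass (OperatorSubsystem A) ℂ A where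
  smul_mem {U} r _ := U.toSubmodule.smul_mem r

instance OperatorSubsystem.instStarMemClass (A : Type*) [CStarAlgebra A] :
    StarMemClass (OperatorSubsystem A) A where
  star_mem {U} _ := U.star_mem'

noncomputable instance OperatorSubsystem.instAddCommGroup {A : Type*} [CStarAlgebra A]
    (U : OperatorSubsystem A) : AddCommGroup U := inferInstance

noncomputable instance OperatorSubsystem.instModule {A : Type*} [CStarAlgebra A]
    (U : OperatorSubsystem A) : Module ℂ U := inferInstance

instance OperatorSubsystem.instStarAddMonoid {A : Type*} [CStarAlgebra A]
    (U : OperatorSubsystem A) : StarAddMonoid U where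
  star_involutive a := Subtype.ext (star_star (a : A))
  star_add a b := Subtype.ext (star_add (a : A) (b : A))

instance OperatorSubsystem.instStarModule {A : Type*} [CStarAlgebra A]
    (U : OperatorSubsystem A) : StarModule ℂ U where
  star_smul c a := Subtype.ext (star_smul c (a : A))

/-- The operator system structure that a subsystem of `A` inherits: a matrix over `U` is positive
if it is positive in `M_p(A)`. -/
def OperatorSubsystem.toOperatorSystem {A : Type*} [CStarAlgebra A] (U : OperatorSubsystem A) :
    OperatorSystem U where
  cone p := {x | x.map (fun u : U => (u : A)) ∈ cstarCone A p}
  unit := ⟨1, U.one_mem'⟩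
  isHermitian {p x} hx := by
    have h := cstarCone_isHermitian hx
    ext i j
    exact congrFun (congrFun h i) j
  add_mem {p x y} hx hy := cstarCone_add_mem hx hy
  smul_mem {p x} r hr hx := cstarCone_smul_mem r hr hx
  proper {p x} hx hy := by
    have h := cstarCone_proper (x := x.map (fun u : U => (u : A))) hx hy
    ext i j
    exact congrFun (congrFun h i) j
  compress_mem {p q} α x hx := by
    have h := cstarCone_compress_mem α hx
    refine (congrArg (· ∈ cstarCone A _) ?_).mpr h
    ext i j
    change U.toSubmodule.subtype (∑ k, ∑ l, (star (α k i) * α l j) • x k l) = _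
    simp only [map_sum]
    rfl
  star_unit := Subtype.ext (star_one A)
  order_unit {p} x hx := by
    obtain ⟨r, hr, h⟩ := cstarCone_order_unit (x.map (fun u : U => (u : A))) (by
      ext i j
      exact congrArg Subtype.val (congrFun (congrFun hx i) j))
    refine ⟨r, hr, ?_⟩
    refine (congrArg (· ∈ cstarCone A _) ?_).mpr h
    ext i j
    by_cases hij : i = j <;> simp [Matrix.diagonal, hij]
  archimedean {p} x hx := by
    refine cstarCone_archimedean (x.map (fun u : U => (u : A))) fun ε hε => ?_
    refine (congrArg (· ∈ cstarCone A _) ?_).mpr (hx ε hε)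
    ext i j
    by_cases hij : i = j <;> simp [Matrix.diagonal, hij]

/-- The dual space of `V`, with the involution `f*(s) = conj (f (s*))`. -/
abbrev DualSpace (V : Type*) [AddCommGroup V] [Module ℂ V] : Type _ := WithConv (V →ₗ[ℂ] ℂ)

/-- For a matrix `G = [g_ij]` of functionals on `V`, the map `s ↦ [g_ij(s)]` into `M_p`. -/
def dualHat {V : Type*} [AddCommGroup V] [Module ℂ V] {p : ℕ}
    (G : Matrix (Fin p) (Fin p) (DualSpace V)) : V →ₗ[ℂ] CStarMatrix (Fin p) (Fin p) ℂ where
  toFun s := CStarMatrix.ofMatrix (Matrix.of fun i j => (G i j).ofConv s)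
  map_add' s t := by ext i j; simp
  map_smul' c s := by ext i j; simp

/-- The cone of `M_p(V^d)`: those `G` for which `s ↦ [g_ij(s)]` is completely positive. -/
def dualCone {V : Type*} [AddCommGroup V] [Module ℂ V] [StarAddMonoid V] [StarModule ℂ V]
    (S : OperatorSystem V) (p : ℕ) : Set (Matrix (Fin p) (Fin p) (DualSpace V)) :=
  {G | IsCompletelyPositive S
    (OperatorSystem.ofCStarAlgebra (CStarMatrix (Fin p) (Fin p) ℂ)) (dualHat G)}

/-- A faithful state on an operator system. -/
structure IsFaithfulState {V : Type*} [AddCommGroup V] [Module ℂ V] [StarAddMonoid V]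
    [StarModule ℂ V] (S : OperatorSystem V) (δ : V →ₗ[ℂ] ℂ) : Prop where
  map_unit : δ S.unit = 1
  nonneg : ∀ x : V, (Matrix.of fun _ _ => x) ∈ S.cone 1 → 0 ≤ δ x
  faithful : ∀ x : V, (Matrix.of fun _ _ => x) ∈ S.cone 1 → δ x = 0 → x = 0

/-- The functional `[s_ij] ↦ ∑ g_ij(s_ij)` on `M_p(V)`. -/
def dualPairing {V : Type*} [AddCommGroup V] [Module ℂ V] {p : ℕ}
    (G : Matrix (Fin p) (Fin p) (DualSpace V)) : Matrix (Fin p) (Fin p) V →ₗ[ℂ] ℂ where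
  toFun x := ∑ i, ∑ j, (G i j).ofConv (x i j)
  map_add' x y := by simp [Finset.sum_add_distrib]
  map_smul' c x := by simp [Finset.mul_sum]

theorem dualPairing_apply {V : Type*} [AddCommGroup V] [Module ℂ V] {p : ℕ}
    (G : Matrix (Fin p) (Fin p) (DualSpace V)) (x : Matrix (Fin p) (Fin p) V) :
    dualPairing G x = ∑ i, ∑ j, (G i j).ofConv (x i j) := rfl

theorem dualPairing_single {V : Type*} [AddCommGroup V] [Module ℂ V] {p : ℕ}
    (G : Matrix (Fin p) (Fin p) (DualSpace V)) (i j : Fin p) (v : V) :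
    dualPairing G (Matrix.single i j v) = (G i j).ofConv v := by
  rw [dualPairing_apply, Finset.sum_eq_single i, Finset.sum_eq_single j]
  · simp
  · intro b _ hb
    simp [hb.symm]
  · simp
  · intro b _ hb
    simp [hb.symm]
  · simp

theorem dualPairing_ext {V : Type*} [AddCommGroup V] [Module ℂ V] {p : ℕ}
    {G H : Matrix (Fin p) (Fin p) (DualSpace V)} (h : ∀ x, dualPairing G x = dualPairing H x) :
    G = H := by
  ext i j v
  rw [← dualPairing_single, h, dualPairing_single]

theorem dualPairing_conjTranspose {V : Type*} [AddCommGroup V] [Module ℂ V] [StarAddMonoid V]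
    [StarModule ℂ V] {p : ℕ} (G : Matrix (Fin p) (Fin p) (DualSpace V))
    (x : Matrix (Fin p) (Fin p) V) : dualPairing Gᴴ x = star (dualPairing G xᴴ) := by
  rw [dualPairing_apply, dualPairing_apply, Finset.sum_comm]
  simp [Matrix.conjTranspose_apply]

theorem OperatorSystem.unit_mem {V : Type*} [AddCommGroup V] [Module ℂ V] [StarAddMonoid V]
    [StarModule ℂ V] (S : OperatorSystem V) (p : ℕ) :
    (Matrix.diagonal fun _ => S.unit : Matrix (Fin p) (Fin p) V) ∈ S.cone p := by
  obtain ⟨r, hr, h⟩ := S.order_unit (p := p) (Matrix.diagonal fun _ => S.unit) (by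
    rw [Matrix.diagonal_conjTranspose]
    congr
    ext
    exact S.star_unit)
  have h2 := S.smul_mem (1 / (r + 1)) (by positivity) h
  convert h2 using 1
  nth_rewrite 3 [← one_smul ℂ (Matrix.diagonal fun _ => S.unit : Matrix (Fin p) (Fin p) V)]
  rw [← add_smul, smul_smul, ← Complex.ofReal_one, ← Complex.ofReal_add,
    ← Complex.ofReal_mul, one_div_mul_cancel (by positivity), Complex.ofReal_one, one_smul]

/-- A linear functional that vanishes on hermitian matrices vanishes. -/
theorem eq_zero_of_hermitian {V : Type*} [AddCommGroup V] [Module ℂ V] [StarAddMonoid V]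
    [StarModule ℂ V] {p : ℕ} (f : Matrix (Fin p) (Fin p) V →ₗ[ℂ] ℂ)
    (hf : ∀ x, xᴴ = x → f x = 0) : f = 0 := by
  ext x
  have h1 := hf (x + xᴴ) (by simp [add_comm])
  have h2 := hf (Complex.I • x + (Complex.I • x)ᴴ) (by simp [add_comm])
  rw [Matrix.conjTranspose_smul, Complex.star_def, Complex.conj_I, neg_smul, ← sub_eq_add_neg,
    ← smul_sub, map_smul, smul_eq_mul, mul_eq_zero, map_sub] at h2
  rw [map_add] at h1
  have h3 := h2.resolve_left Complex.I_ne_zero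
  rw [LinearMap.zero_apply]
  linear_combination (h1 + h3) / 2

theorem dualPairing_real {V : Type*} [AddCommGroup V] [Module ℂ V] [StarAddMonoid V]
    [StarModule ℂ V] (S : OperatorSystem V) {p : ℕ} {G : Matrix (Fin p) (Fin p) (DualSpace V)}
    (hG : ∀ x ∈ S.cone p, 0 ≤ dualPairing G x) (x : Matrix (Fin p) (Fin p) V) (hx : xᴴ = x) :
    star (dualPairing G x) = dualPairing G x := by
  obtain ⟨r, hr, h⟩ := S.order_unit x hx
  have h1 := (IsSelfAdjoint.of_nonneg (hG _ h)).star_eq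
  have h2 := (IsSelfAdjoint.of_nonneg (hG _ (S.smul_mem r hr (S.unit_mem p)))).star_eq
  rw [map_add, star_add, h2] at h1
  exact add_left_cancel h1

theorem isHermitian_of_dualPairing_nonneg {V : Type*} [AddCommGroup V] [Module ℂ V]
    [StarAddMonoid V] [StarModule ℂ V] (S : OperatorSystem V) {p : ℕ}
    {G : Matrix (Fin p) (Fin p) (DualSpace V)}
    (hG : ∀ x ∈ S.cone p, 0 ≤ dualPairing G x) : Gᴴ = G := by
  refine dualPairing_ext fun x => ?_
  have h := eq_zero_of_hermitian (dualPairing Gᴴ - dualPairing G) fun x hx => by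
    rw [LinearMap.sub_apply, dualPairing_conjTranspose, hx, dualPairing_real S hG x hx, sub_self]
  exact sub_eq_zero.mp (LinearMap.congr_fun h x)

theorem dualPairing_compress {V : Type*} [AddCommGroup V] [Module ℂ V] {p q : ℕ}
    (α : Matrix (Fin p) (Fin q) ℂ) (G : Matrix (Fin p) (Fin p) (DualSpace V))
    (x : Matrix (Fin q) (Fin q) V) :
    dualPairing (scalarCompress α G) x = dualPairing G (scalarCompress αᵀ x) := by
  have key : ∀ (f : Fin q → Fin q → Fin p → Fin p → ℂ),
      ∑ i, ∑ j, ∑ k, ∑ l, f i j k l = ∑ k, ∑ l, ∑ i, ∑ j, f i j k l := by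
    intro f
    calc _ = ∑ i, ∑ k, ∑ j, ∑ l, f i j k l := Finset.sum_congr rfl fun i _ => Finset.sum_comm
      _ = ∑ k, ∑ i, ∑ l, ∑ j, f i j k l := by
        rw [Finset.sum_comm]
        exact Finset.sum_congr rfl fun k _ => Finset.sum_congr rfl fun i _ => Finset.sum_comm
      _ = _ := Finset.sum_congr rfl fun k _ => Finset.sum_comm
  have hs : ∀ (s : Fin p → Fin p → DualSpace V) (v : V),
      (∑ k, ∑ l, s k l).ofConv v = ∑ k, ∑ l, (s k l).ofConv v := by
    intro s v
    have : ∀ (t : Fin p → DualSpace V) (v : V), (∑ k, t k).ofConv v = ∑ k, (t k).ofConv v := by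
      intro t v
      exact map_sum ((LinearMap.applyₗ v).comp (WithConv.linearEquiv ℂ (V →ₗ[ℂ] ℂ)).toLinearMap) t _
    rw [this]
    exact Finset.sum_congr rfl fun k _ => this _ _
  simp only [dualPairing_apply, scalarCompress, Matrix.of_apply, hs, map_sum]
  rw [key]
  simp [Matrix.transpose_apply]

open scoped MatrixOrder in
theorem posSemidef_iff_gram {n : Type*} [Fintype n] [DecidableEq n] (M : Matrix n n ℂ) :
    M.PosSemidef ↔ ∃ B : Matrix n n ℂ, M = Bᴴ * B :=
  Matrix.nonneg_iff_posSemidef.symm.trans CStarAlgebra.nonneg_iff_eq_star_mul_self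

/-- Positivity in `M_q(M_p)` through the quadratic form of the associated `qp × qp` matrix. -/
theorem mem_cstarCone_matrix_iff {q p : ℕ}
    (X : Matrix (Fin q) (Fin q) (CStarMatrix (Fin p) (Fin p) ℂ)) :
    X ∈ cstarCone (CStarMatrix (Fin p) (Fin p) ℂ) q ↔
      (Matrix.of fun (a b : Fin q × Fin p) => X a.1 b.1 a.2 b.2).PosSemidef := by
  rw [posSemidef_iff_gram]
  have ha : ∀ (Y : Matrix (Fin q) (Fin q) (CStarMatrix (Fin p) (Fin p) ℂ)) (a b : Fin q)
      (i j : Fin p), (Yᴴ * Y) a b i j = ∑ c, ∑ k, star (Y c a k i) * Y c b k j := by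
    intro Y a b i j
    let e : CStarMatrix (Fin p) (Fin p) ℂ →+ ℂ :=
      { toFun := fun M => M i j, map_zero' := rfl, map_add' := fun _ _ => rfl }
    exact map_sum e (fun c => star (Y c a) * Y c b) Finset.univ
  constructor
  · rintro ⟨Y, rfl⟩
    refine ⟨Matrix.of fun a b => Y a.1 b.1 a.2 b.2, ?_⟩
    ext a b
    rw [Matrix.of_apply, ha, Matrix.mul_apply, Fintype.sum_prod_type]
    rfl
  · rintro ⟨B, hB⟩
    refine ⟨Matrix.of fun a b => CStarMatrix.ofMatrix (Matrix.of fun i j => B (a, i) (b, j)), ?_⟩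
    ext a b i j
    rw [ha]
    have := congrFun (congrFun hB (a, i)) (b, j)
    rw [Matrix.of_apply, Matrix.mul_apply, Fintype.sum_prod_type] at this
    exact this

/-- `s ↦ [g_ij(s)]` is completely positive if and only if `[s_ij] ↦ ∑ g_ij(s_ij)` is positive. -/
theorem mem_dualCone_iff {V : Type*} [AddCommGroup V] [Module ℂ V] [StarAddMonoid V]
    [StarModule ℂ V] (S : OperatorSystem V) {p : ℕ} (G : Matrix (Fin p) (Fin p) (DualSpace V)) :
    G ∈ dualCone S p ↔ ∀ x ∈ S.cone p, 0 ≤ dualPairing G x := by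
  constructor
  · intro h x hx
    have h1 := (mem_cstarCone_matrix_iff _).mp (h p x hx)
    have h2 := h1.dotProduct_mulVec_nonneg fun a => if a.1 = a.2 then 1 else 0
    convert h2 using 1
    simp [dotProduct, Matrix.mulVec, Fintype.sum_prod_type, dualPairing_apply, dualHat, apply_ite]
  · intro h q x hx
    have hG := isHermitian_of_dualPairing_nonneg S h
    refine (mem_cstarCone_matrix_iff _).mpr (Matrix.PosSemidef.of_dotProduct_mulVec_nonneg ?_ ?_)
    · ext a b
      have h1 := S.isHermitian hx
      have h2 : G a.2 b.2 = star (G b.2 a.2) := (congrFun (congrFun hG a.2) b.2).symm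
      have h3 : x a.1 b.1 = star (x b.1 a.1) := (congrFun (congrFun h1 a.1) b.1).symm
      change star ((G b.2 a.2).ofConv (x b.1 a.1)) = (G a.2 b.2).ofConv (x a.1 b.1)
      rw [h2, h3, LinearMap.intrinsicStar_apply, star_star]
    · intro ξ
      convert h _ (S.compress_mem (Matrix.of fun a i => ξ (a, i)) hx) using 1
      simp only [dotProduct, Matrix.mulVec, Fintype.sum_prod_type, dualPairing_apply,
        scalarCompress, Matrix.of_apply, map_sum, map_smul, smul_eq_mul, Finset.mul_sum,
        Pi.star_apply]
      rw [Finset.sum_comm]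
      refine Finset.sum_congr rfl fun i _ => ?_
      rw [Finset.sum_comm (s := (Finset.univ : Finset (Fin p)))]
      refine Finset.sum_congr rfl fun a _ => ?_
      rw [Finset.sum_comm (s := (Finset.univ : Finset (Fin p)))]
      refine Finset.sum_congr rfl fun b _ => Finset.sum_congr rfl fun j _ => ?_
      change star (ξ (a, i)) * ((G i j).ofConv (x a b) * ξ (b, j)) = _
      ring

/-- Domination of a linear functional by a strictly positive one, over an Archimedean cone with
order unit in finite dimensions. -/
theorem exists_dominate_coord {d : ℕ} (C : Set (Fin d → ℝ)) (e : Fin d → ℝ)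
    (hadd : ∀ x ∈ C, ∀ y ∈ C, x + y ∈ C) (hsmul : ∀ r : ℝ, 0 ≤ r → ∀ x ∈ C, r • x ∈ C)
    (hunit : ∀ x, ∃ r : ℝ, 0 ≤ r ∧ r • e + x ∈ C)
    (harch : ∀ x, (∀ ε : ℝ, 0 < ε → ε • e + x ∈ C) → x ∈ C)
    (f g : (Fin d → ℝ) →ₗ[ℝ] ℝ) (hf : ∀ x ∈ C, x ≠ 0 → 0 < f x) :
    ∃ r : ℝ, 0 ≤ r ∧ ∀ x ∈ C, 0 ≤ r * f x + g x := by
  have he : e ∈ C := by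
    obtain ⟨r, hr, h⟩ := hunit e
    have := hsmul (1 / (r + 1)) (by positivity) _ h
    nth_rewrite 2 [← one_smul ℝ e] at this
    rwa [← add_smul, smul_smul, one_div_mul_cancel (by positivity), one_smul] at this
  have h0 : (0 : Fin d → ℝ) ∈ C := by simpa using hsmul 0 le_rfl e he
  obtain ⟨R, hR, hint⟩ : ∃ R : ℝ, 0 < R ∧ ∀ y : Fin d → ℝ, (R * ‖y‖) • e + y ∈ C := by
    choose r hr hr' using fun i : Fin d => hunit (Pi.single i 1)
    choose s hs hs' using fun i : Fin d => hunit (-Pi.single i 1)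
    refine ⟨∑ i, (r i + s i) + 1, by
      have := Finset.sum_nonneg fun i (_ : i ∈ Finset.univ) => add_nonneg (hr i) (hs i)
      linarith, fun y => ?_⟩
    have key : ∀ i, ((r i + s i) * ‖y‖) • e + Pi.single i (y i) ∈ C := by
      intro i
      have hy := norm_le_pi_norm y i
      rw [Real.norm_eq_abs] at hy
      rcases le_total 0 (y i) with hi | hi
      · rw [abs_of_nonneg hi] at hy
        have h1 := hsmul _ hi _ (hr' i)
        have h2 := hsmul ((r i + s i) * ‖y‖ - y i * r i) (by nlinarith [hr i, hs i, norm_nonneg y]) e he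
        convert hadd _ h2 _ h1 using 1
        rw [smul_add, smul_smul, ← add_assoc, ← add_smul, sub_add_cancel, ← Pi.single_smul]
        simp
      · rw [abs_of_nonpos hi] at hy
        have h1 := hsmul (-y i) (by linarith) _ (hs' i)
        have h2 := hsmul ((r i + s i) * ‖y‖ - (-y i) * s i) (by nlinarith [hr i, hs i, norm_nonneg y]) e he
        convert hadd _ h2 _ h1 using 1
        rw [smul_add, smul_smul, ← add_assoc, ← add_smul, sub_add_cancel, smul_neg, ← Pi.single_smul,
          ← Pi.single_neg]
        simp
    have h1 : ∑ i, (((r i + s i) * ‖y‖) • e + Pi.single i (y i)) ∈ C :=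
      Finset.sum_induction _ (· ∈ C) (fun a b ha hb => hadd a ha b hb) h0 fun i _ => key i
    rw [Finset.sum_add_distrib, Finset.univ_sum_single, ← Finset.sum_smul, ← Finset.sum_mul] at h1
    have h2 := hadd _ (hsmul ‖y‖ (norm_nonneg y) e he) _ h1
    convert h2 using 1
    rw [← add_assoc, ← add_smul]
    congr 2
    ring
  have hclosed : IsClosed C := by
    refine isClosed_of_closure_subset fun x hx => harch x fun ε hε => ?_
    obtain ⟨y, hy, hxy⟩ := Metric.mem_closure_iff.mp hx (ε / R) (by positivity)
    rw [dist_eq_norm, lt_div_iff₀ hR] at hxy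
    have h1 := hadd _ hy _ (hint (x - y))
    have h2 := hsmul (ε - R * ‖x - y‖) (by linarith) e he
    convert hadd _ h2 _ h1 using 1
    rw [sub_smul]
    abel
  have hfc : Continuous f := f.continuous_of_finiteDimensional
  have hgc : Continuous g := g.continuous_of_finiteDimensional
  let K : Set (Fin d → ℝ) := C ∩ Metric.sphere 0 1
  have hK : IsCompact K := (isCompact_sphere 0 1).inter_left hclosed
  have hKpos : ∀ x ∈ K, 0 < f x := fun x hx => hf x hx.1 fun h => by
    have := hx.2
    simp [h] at this
  obtain ⟨r, hr, hr'⟩ : ∃ r : ℝ, 0 ≤ r ∧ ∀ x ∈ K, -(g x) / f x ≤ r := by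
    have hcont : ContinuousOn (fun x => -(g x) / f x) K :=
      (hgc.neg.continuousOn).div hfc.continuousOn fun x hx => (hKpos x hx).ne'
    obtain ⟨b, hb⟩ := hK.bddAbove_image hcont
    exact ⟨max b 0, le_max_right _ _, fun x hx =>
      (hb (Set.mem_image_of_mem _ hx)).trans (le_max_left _ _)⟩
  refine ⟨r, hr, fun x hx => ?_⟩
  rcases eq_or_ne x 0 with rfl | hx0
  · simp
  have hn : 0 < ‖x‖ := norm_pos_iff.mpr hx0
  have hxK : ‖x‖⁻¹ • x ∈ K := ⟨hsmul _ (by positivity) _ hx, by simp [norm_smul, hn.ne']⟩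
  have h1 := hr' _ hxK
  rw [div_le_iff₀ (hKpos _ hxK), map_smul, map_smul, smul_eq_mul, smul_eq_mul] at h1
  have h2 : 0 ≤ ‖x‖⁻¹ * (r * f x + g x) := by linarith
  exact nonneg_of_mul_nonneg_right h2 (by positivity)

theorem IsFaithfulState.trace_pos {V : Type*} [AddCommGroup V] [Module ℂ V] [StarAddMonoid V]
    [StarModule ℂ V] {S : OperatorSystem V} {δ : V →ₗ[ℂ] ℂ} (hδ : IsFaithfulState S δ) {p : ℕ}
    {x : Matrix (Fin p) (Fin p) V} (hx : x ∈ S.cone p) :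
    0 ≤ ∑ i, δ (x i i) ∧ (x ≠ 0 → 0 < ∑ i, δ (x i i)) := by
  have hd : ∀ i, (Matrix.of fun _ _ => x i i) ∈ S.cone 1 := by
    intro i
    convert S.compress_mem (Matrix.of fun k (_ : Fin 1) => if k = i then 1 else 0) hx using 1
    ext a b
    simp [scalarCompress, apply_ite]
  have h0 : 0 ≤ ∑ i, δ (x i i) := Finset.sum_nonneg fun i _ => hδ.nonneg _ (hd i)
  refine ⟨h0, fun hne => lt_of_le_of_ne h0 fun h => hne ?_⟩
  have hz : ∀ i, x i i = 0 := fun i => hδ.faithful _ (hd i)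
    ((Finset.sum_eq_zero_iff_of_nonneg fun i _ => hδ.nonneg _ (hd i)).mp h.symm i
      (Finset.mem_univ i))
  ext i j
  rcases eq_or_ne i j with rfl | hij
  · exact hz i
  have hc : ∀ c : ℂ, (Matrix.of fun _ _ => c • x i j + star c • x j i :
      Matrix (Fin 1) (Fin 1) V) ∈ S.cone 1 := by
    intro c
    convert S.compress_mem
      (Matrix.of fun k (_ : Fin 1) => (if k = i then 1 else 0) + (if k = j then c else 0)) hx using 1
    ext a b
    have h1 : ∀ k l, (star ((if k = i then (1 : ℂ) else 0) + (if k = j then c else 0)) *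
        ((if l = i then 1 else 0) + (if l = j then c else 0))) • x k l =
        (if k = i then (if l = i then x k l else 0) else 0) +
        (if k = i then (if l = j then c • x k l else 0) else 0) +
        ((if k = j then (if l = i then star c • x k l else 0) else 0) +
        (if k = j then (if l = j then (star c * c) • x k l else 0) else 0)) := by
      intro k l
      by_cases h1 : k = i <;> by_cases h2 : k = j <;> by_cases h3 : l = i <;>
        by_cases h4 : l = j <;> simp [h1, h2, h3, h4, hij, hij.symm]
    simp only [scalarCompress, Matrix.of_apply, h1, Finset.sum_add_distrib]
    simp [hz]
  have hq : ∀ c : ℂ, c • x i j + star c • x j i = 0 := by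
    intro c
    have := S.proper (hc c) (by
      convert hc (-c) using 1
      ext a b
      simp [add_comm])
    exact congrFun (congrFun this 0) 0
  have e1 := hq 1
  have e2 := hq Complex.I
  simp only [one_smul, star_one] at e1
  rw [Complex.star_def, Complex.conj_I, neg_smul, ← sub_eq_add_neg, ← smul_sub] at e2
  have e3 := (smul_eq_zero.mp e2).resolve_left Complex.I_ne_zero
  have e4 : (2 : ℂ) • x i j = 0 := by
    rw [two_smul]
    calc x i j + x i j = (x i j + x j i) + (x i j - x j i) := by abel
      _ = 0 := by rw [e1, e3, add_zero]
  exact (smul_eq_zero.mp e4).resolve_left two_ne_zero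

theorem dualPairing_diagonal {V : Type*} [AddCommGroup V] [Module ℂ V] {p : ℕ}
    (δ : V →ₗ[ℂ] ℂ) (x : Matrix (Fin p) (Fin p) V) :
    dualPairing (Matrix.diagonal fun _ => WithConv.toConv δ) x = ∑ i, δ (x i i) := by
  rw [dualPairing_apply]
  refine Finset.sum_congr rfl fun i _ => ?_
  rw [Finset.sum_eq_single i]
  · simp
  · intro j _ hj
    simp [Matrix.diagonal_apply_ne' _ hj]
  · simp

theorem dualPairing_add {V : Type*} [AddCommGroup V] [Module ℂ V] {p : ℕ}
    (G H : Matrix (Fin p) (Fin p) (DualSpace V)) (x : Matrix (Fin p) (Fin p) V) :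
    dualPairing (G + H) x = dualPairing G x + dualPairing H x := by
  simp [dualPairing_apply, Finset.sum_add_distrib]

theorem dualPairing_smul {V : Type*} [AddCommGroup V] [Module ℂ V] {p : ℕ}
    (c : ℂ) (G : Matrix (Fin p) (Fin p) (DualSpace V)) (x : Matrix (Fin p) (Fin p) V) :
    dualPairing (c • G) x = c * dualPairing G x := by
  simp [dualPairing_apply, Finset.mul_sum]

theorem dualCone_order_unit {V : Type*} [AddCommGroup V] [Module ℂ V] [StarAddMonoid V]
    [StarModule ℂ V] [FiniteDimensional ℂ V] (S : OperatorSystem V) (δ : V →ₗ[ℂ] ℂ)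
    (hδ : IsFaithfulState S δ) {p : ℕ} (G : Matrix (Fin p) (Fin p) (DualSpace V)) (hG : Gᴴ = G) :
    ∃ r : ℝ, 0 ≤ r ∧
      (r : ℂ) • Matrix.diagonal (fun _ => WithConv.toConv δ) + G ∈ dualCone S p := by
  have : FiniteDimensional ℝ V := FiniteDimensional.complexToReal V
  let H : Submodule ℝ (Matrix (Fin p) (Fin p) V) :=
    { carrier := {x | xᴴ = x}
      add_mem' := fun {x y} hx hy => by
        rw [Set.mem_ofPred_eq] at *
        rw [Matrix.conjTranspose_add, hx, hy]
      zero_mem' := Matrix.conjTranspose_zero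
      smul_mem' := fun r x hx => by
        rw [Set.mem_ofPred_eq] at *
        rw [← Complex.coe_smul, Matrix.conjTranspose_smul, hx, Complex.star_def,
          Complex.conj_ofReal] }
  let b := (Module.finBasis ℝ H).equivFun
  let X : (Fin (Module.finrank ℝ H) → ℝ) →ₗ[ℝ] Matrix (Fin p) (Fin p) V :=
    H.subtype ∘ₗ b.symm.toLinearMap
  have hXh : ∀ c, (X c)ᴴ = X c := fun c => (b.symm c).2
  have hXs : ∀ x : Matrix (Fin p) (Fin p) V, xᴴ = x → ∃ c, X c = x := fun x hx =>
    ⟨b ⟨x, hx⟩, by simp [X]⟩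
  obtain ⟨e, he⟩ := hXs _ (S.isHermitian (S.unit_mem p))
  let D : Matrix (Fin p) (Fin p) (DualSpace V) := Matrix.diagonal fun _ => WithConv.toConv δ
  have hD : ∀ x, dualPairing D x = ∑ i, δ (x i i) := dualPairing_diagonal δ
  let f : Matrix (Fin p) (Fin p) (DualSpace V) → (Fin (Module.finrank ℝ H) → ℝ) →ₗ[ℝ] ℝ :=
    fun K => Complex.reLm ∘ₗ (dualPairing K).restrictScalars ℝ ∘ₗ X
  have hf : ∀ K c, f K c = (dualPairing K (X c)).re := fun _ _ => rfl
  obtain ⟨r, hr, h⟩ := exists_dominate_coord {c | X c ∈ S.cone p} e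
    (fun x hx y hy => by
      rw [Set.mem_ofPred_eq, map_add]
      exact S.add_mem hx hy)
    (fun r hr x hx => by
      rw [Set.mem_ofPred_eq, map_smul, ← Complex.coe_smul]
      exact S.smul_mem r hr hx)
    (fun x => by
      obtain ⟨r, hr, h⟩ := S.order_unit (X x) (hXh x)
      refine ⟨r, hr, ?_⟩
      rw [Set.mem_ofPred_eq, map_add, map_smul, he, ← Complex.coe_smul]
      exact h)
    (fun x hx => S.archimedean (X x) fun ε hε => by
      have := hx ε hε
      rw [Set.mem_ofPred_eq, map_add, map_smul, he, ← Complex.coe_smul] at this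
      exact this)
    (f D) (f G)
    (fun x hx hx0 => by
      rw [hf, hD]
      have h1 : X x ≠ 0 := fun h => hx0 (b.symm.injective (Subtype.ext (by simpa [X] using h)))
      exact (Complex.pos_iff.mp ((hδ.trace_pos hx).2 h1)).1)
  refine ⟨r, hr, (mem_dualCone_iff S _).mpr fun x hx => ?_⟩
  obtain ⟨c, rfl⟩ := hXs x (S.isHermitian hx)
  have h1 := h c hx
  rw [hf, hf] at h1
  rw [dualPairing_add, dualPairing_smul, Complex.nonneg_iff]
  have h2 : (dualPairing G (X c)).im = 0 := by
    have := dualPairing_conjTranspose G (X c)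
    rw [hG, hXh] at this
    exact Complex.conj_eq_iff_im.mp this.symm
  have h3 : (dualPairing D (X c)).im = 0 := by
    rw [hD]
    exact (Complex.nonneg_iff.mp (hδ.trace_pos hx).1).2.symm
  have h4 : (dualPairing (Matrix.diagonal fun _ => WithConv.toConv δ) (X c)).im = 0 := h3
  constructor
  · rw [Complex.add_re, Complex.re_ofReal_mul]
    exact h1
  · rw [Complex.add_im, Complex.im_ofReal_mul, h4, h2]
    simp

/-- The dual `S^d` of a finite-dimensional operator system `S`, as an operator system whose order
unit is a given faithful state `δ` of `S`. -/
def OperatorSystem.dual {V : Type*} [AddCommGroup V] [Module ℂ V] [StarAddMonoid V]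
    [StarModule ℂ V] [FiniteDimensional ℂ V] (S : OperatorSystem V) (δ : V →ₗ[ℂ] ℂ)
    (hδ : IsFaithfulState S δ) : OperatorSystem (DualSpace V) where
  cone := dualCone S
  unit := WithConv.toConv δ
  isHermitian {p G} hG := isHermitian_of_dualPairing_nonneg S ((mem_dualCone_iff S G).mp hG)
  add_mem {p G H} hG hH := by
    rw [mem_dualCone_iff] at *
    intro x hx
    rw [dualPairing_add]
    exact add_nonneg (hG x hx) (hH x hx)
  smul_mem {p G} r hr hG := by
    rw [mem_dualCone_iff] at *
    intro x hx
    rw [dualPairing_smul]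
    exact mul_nonneg (Complex.zero_le_real.mpr hr) (hG x hx)
  proper {p G} hG hG' := by
    rw [mem_dualCone_iff] at *
    have hneg : ∀ x, dualPairing (-G) x = -dualPairing G x := fun x => by
      simp [dualPairing_apply]
    have h0 : ∀ x ∈ S.cone p, dualPairing G x = 0 := fun x hx =>
      le_antisymm (by
        have := hG' x hx
        rw [hneg] at this
        exact neg_nonneg.mp this) (hG x hx)
    have h1 := eq_zero_of_hermitian (dualPairing G) fun x hx => by
      obtain ⟨r, hr, h⟩ := S.order_unit x hx
      have h2 := h0 _ h
      rw [map_add, h0 _ (S.smul_mem r hr (S.unit_mem p)), zero_add] at h2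
      exact h2
    refine dualPairing_ext fun x => ?_
    rw [h1]
    simp [dualPairing_apply]
  compress_mem {p q} α G hG := by
    rw [mem_dualCone_iff] at *
    intro x hx
    rw [dualPairing_compress]
    exact hG _ (S.compress_mem _ hx)
  star_unit := by
    have h := isHermitian_of_dualPairing_nonneg S (p := 1)
      (G := Matrix.diagonal fun _ => WithConv.toConv δ) fun x hx => by
        rw [dualPairing_diagonal]
        exact (hδ.trace_pos hx).1
    have := congrFun (congrFun h 0) 0
    simpa using this
  order_unit G hG := dualCone_order_unit S δ hδ G hG
  archimedean {p} G hG := by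
    simp only [mem_dualCone_iff] at *
    intro x hx
    have h0 := (hδ.trace_pos hx).1
    rw [Complex.nonneg_iff] at h0
    have h1 : ∀ ε : ℝ, 0 < ε → 0 ≤ ε * (∑ i, δ (x i i)).re + (dualPairing G x).re ∧
        (dualPairing G x).im = 0 := by
      intro ε hε
      have h2 := hG ε hε x hx
      rw [dualPairing_add, dualPairing_smul, dualPairing_diagonal, Complex.nonneg_iff,
        Complex.add_re, Complex.add_im, Complex.re_ofReal_mul, Complex.im_ofReal_mul, ← h0.2,
        mul_zero, zero_add] at h2
      exact ⟨h2.1, h2.2.symm⟩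
    rw [Complex.nonneg_iff]
    refine ⟨le_of_forall_pos_le_add fun η hη => ?_, (h1 1 one_pos).2.symm⟩
    have hpos : 0 < (∑ i, δ (x i i)).re + 1 := by linarith [h0.1]
    have h2 := (h1 (η / ((∑ i, δ (x i i)).re + 1)) (by positivity)).1
    have h3 : η / ((∑ i, δ (x i i)).re + 1) * (∑ i, δ (x i i)).re ≤ η := by
      rw [div_mul_eq_mul_div, div_le_iff₀ hpos]
      nlinarith
    linarith

/-- A unitary representation of a group on a nonzero complex Hilbert space. -/
structure UnitaryRepresentation (G : Type) [Group G] where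
  /-- the Hilbert space -/
  H : Type
  [normed : NormedAddCommGroup H]
  [inner : InnerProductSpace ℂ H]
  [complete : CompleteSpace H]
  [nontrivial : Nontrivial H]
  /-- the homomorphism into the unitary group of `H` -/
  π : G →* unitary (H →L[ℂ] H)

attribute [instance] UnitaryRepresentation.normed UnitaryRepresentation.inner
  UnitaryRepresentation.complete UnitaryRepresentation.nontrivial

/-- The C*-algebra of bounded families of operators, indexed by all unitary representations
of `G`. -/
abbrev BoundedFamilies (G : Type) [Group G] : Type _ :=
  lp (fun ρ : UnitaryRepresentation G => ρ.H →L[ℂ] ρ.H) ∞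

noncomputable instance BoundedFamilies.instCStarAlgebra (G : Type) [Group G] :
    CStarAlgebra (BoundedFamilies G) where

/-- The operator of `g` in the direct sum of all unitary representations of `G`. -/
noncomputable def universalUnitary {G : Type} [Group G] (g : G) : BoundedFamilies G :=
  ⟨fun ρ => (ρ.π g : ρ.H →L[ℂ] ρ.H), memℓp_infty ⟨1, by
    rintro _ ⟨ρ, rfl⟩
    exact (CStarRing.norm_coe_unitary (ρ.π g)).le⟩⟩

/-- The full group C*-algebra `C*(G)` of a discrete group `G`: the completion of the group algebra
in the norm `‖a‖ = sup ‖π(a)‖` over all unitary representations `π`, realized as the C*-algebra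
generated by `G` in the direct sum of all unitary representations. -/
def FullGroupCStarAlgebra (G : Type) [Group G] : Type _ :=
  (StarAlgebra.adjoin ℂ (Set.range (universalUnitary (G := G)))).topologicalClosure

noncomputable instance FullGroupCStarAlgebra.instCStarAlgebra (G : Type) [Group G] :
    CStarAlgebra (FullGroupCStarAlgebra G) :=
  haveI := StarSubalgebra.isClosed_topologicalClosure
    (StarAlgebra.adjoin ℂ (Set.range (universalUnitary (G := G))))
  StarSubalgebra.cstarAlgebra
    (StarAlgebra.adjoin ℂ (Set.range (universalUnitary (G := G)))).topologicalClosure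

/-- The canonical unitary of `C*(G)` that belongs to `g`. -/
noncomputable def FullGroupCStarAlgebra.of {G : Type} [Group G] (g : G) :
    FullGroupCStarAlgebra G :=
  (⟨universalUnitary g, StarSubalgebra.le_topologicalClosure _
    (StarAlgebra.subset_adjoin ℂ _ ⟨g, rfl⟩)⟩ :
    (StarAlgebra.adjoin ℂ (Set.range (universalUnitary (G := G)))).topologicalClosure)

/-- `w_1 = 1` and `w_2, …, w_n` are the universal unitaries that generate `C*(F_{n-1})`
(the indices are shifted: `freeUnitary n 0 = 1`). -/
noncomputable def freeUnitary (n : ℕ) (i : Fin n) :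
    FullGroupCStarAlgebra (FreeGroup (Fin (n - 1))) :=
  if h : (i : ℕ) = 0 then 1
  else FullGroupCStarAlgebra.of (FreeGroup.of ⟨i - 1, by omega⟩)

/-- The operator system `W_n` in `C*(F_{n-1})` spanned by the elements `w_i w_j*`. -/
noncomputable def OSW (n : ℕ) (hn : 2 ≤ n) :
    OperatorSubsystem (FullGroupCStarAlgebra (FreeGroup (Fin (n - 1)))) where
  toSubmodule := Submodule.span ℂ
    (Set.range fun ij : Fin n × Fin n => freeUnitary n ij.1 * star (freeUnitary n ij.2))
  one_mem' := Submodule.subset_span ⟨(⟨0, by omega⟩, ⟨0, by omega⟩), by simp [freeUnitary]⟩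
  star_mem' := by
    intro a ha
    change a ∈ Submodule.span ℂ _ at ha
    change star a ∈ Submodule.span ℂ _
    induction ha using Submodule.span_induction with
    | mem x hx =>
      obtain ⟨⟨i, j⟩, rfl⟩ := hx
      exact Submodule.subset_span ⟨(j, i), by simp⟩
    | zero => simp
    | add x y _ _ hx hy => rw [star_add]; exact Submodule.add_mem _ hx hy
    | smul c x _ hx => rw [star_smul]; exact Submodule.smul_mem _ _ hx

instance OSW.instFiniteDimensional (n : ℕ) (hn : 2 ≤ n) : FiniteDimensional ℂ (OSW n hn) :=
  FiniteDimensional.span_of_finite ℂ (Set.finite_range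
    fun ij : Fin n × Fin n => freeUnitary n ij.1 * star (freeUnitary n ij.2))

/-- The operator subsystem `E_n` of `M_n` of all matrices with constant diagonal. -/
def OSE (n : ℕ) : OperatorSubsystem (CStarMatrix (Fin n) (Fin n) ℂ) where
  carrier := {a | ∀ i j, a i i = a j j}
  add_mem' ha hb i j := by simp [ha i j, hb i j]
  zero_mem' i j := rfl
  smul_mem' c a ha i j := by simp [ha i j]
  one_mem' i j := by simp
  star_mem' ha i j := by
    rw [CStarMatrix.star_apply, CStarMatrix.star_apply, ha i j]

/-!
The isomorphism is `f ↦ [f(w_i w_j*)]`. It is completely positive because `[w_i w_j*]` is a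
positive matrix over `W_n`, and injective because its entries span `W_n`. Conversely, a positive
matrix over `E_n` is the Gram matrix of vectors `v_{k,i}`, and the constant diagonal says that for
each `i` the family `(v_{k,i})_k` has the same Gram matrix. So there are unitaries carrying
`v_{k,i}` to `v_{k,0}` for all `k`; by freeness they define a representation `π` of the free
group, and the functionals `s ↦ ⟪v_{k,0}, π(s) v_{l,0}⟫` form a positive matrix over `W_n^d` that
is mapped to the given one. Surjectivity follows, as every operator system is spanned by its
positive elements.
-/

section OperatorSystem

variable {V W : Type*} [AddCommGroup V] [Module ℂ V] [StarAddMonoid V] [StarModule ℂ V]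
  [AddCommGroup W] [Module ℂ W] [StarAddMonoid W] [StarModule ℂ W]

/-- The positive elements of an operator system: its cone at the first matrix level, with
`1 × 1` matrices read as elements. -/
def OperatorSystem.positives (S : OperatorSystem V) : Set V :=
  {x | (Matrix.of fun _ _ => x) ∈ S.cone 1}

/-- The linear functionals that are nonnegative on the positive elements. -/
def OperatorSystem.positiveFunctionals (S : OperatorSystem V) : Set (V →ₗ[ℂ] ℂ) :=
  {f | ∀ x ∈ S.positives, 0 ≤ f x}

theorem OperatorSystem.unit_mem_positives (S : OperatorSystem V) : S.unit ∈ S.positives := by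
  refine (congrArg (· ∈ S.cone 1) ?_).mpr (S.unit_mem 1)
  ext i j
  simp [Subsingleton.elim i j]

theorem OperatorSystem.exists_smul_unit_add_mem_positives (S : OperatorSystem V) {x : V}
    (hx : IsSelfAdjoint x) : ∃ r : ℝ, (r : ℂ) • S.unit + x ∈ S.positives := by
  obtain ⟨r, -, hr⟩ := S.order_unit (p := 1) (Matrix.of fun _ _ => x) (by ext1; exact hx)
  refine ⟨r, (congrArg (· ∈ S.cone 1) ?_).mpr hr⟩
  ext i j
  simp [Subsingleton.elim i j]

theorem OperatorSystem.span_positives (S : OperatorSystem V) :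
    Submodule.span ℂ S.positives = ⊤ := by
  rw [← top_le_iff, ← span_selfAdjoint, Submodule.span_le]
  intro x hx
  obtain ⟨r, hr⟩ := S.exists_smul_unit_add_mem_positives hx
  have hunit := Submodule.subset_span (R := ℂ) S.unit_mem_positives
  simpa using Submodule.sub_mem _ (Submodule.subset_span hr) (Submodule.smul_mem _ (r : ℂ) hunit)

theorem completelyOrderIsomorphic_of_exists_lift {S : OperatorSystem V} {T : OperatorSystem W}
    (φ : V →ₗ[ℂ] W) (hinj : Function.Injective φ) (hφ : IsCompletelyPositive S T φ)
    (hlift : ∀ p, ∀ y ∈ T.cone p, ∃ x ∈ S.cone p, x.map φ = y) :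
    CompletelyOrderIsomorphic S T := by
  have hsurj : LinearMap.range φ = ⊤ := by
    rw [← top_le_iff, ← T.span_positives, Submodule.span_le]
    intro y hy
    obtain ⟨x, -, hx⟩ := hlift 1 _ hy
    exact ⟨x 0 0, congrFun₂ hx 0 0⟩
  let e := LinearEquiv.ofBijective φ ⟨hinj, LinearMap.range_eq_top.mp hsurj⟩
  refine ⟨e, hφ, fun p y hy => ?_⟩
  obtain ⟨x, hx, rfl⟩ := hlift p y hy
  refine (congrArg (· ∈ S.cone p) ?_).mpr hx
  ext i j
  exact e.symm_apply_apply (x i j)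

/-- A finite set of positive functionals spans all of them, and its normalized sum is a faithful
state. -/
theorem OperatorSystem.exists_isFaithfulState [FiniteDimensional ℂ V] (S : OperatorSystem V)
    (hunit : S.unit ≠ 0)
    (hsep : ∀ x ∈ S.positives, (∀ f ∈ S.positiveFunctionals, f x = 0) → x = 0) :
    ∃ δ : V →ₗ[ℂ] ℂ, IsFaithfulState S δ := by
  obtain ⟨t, ht, hspan⟩ := (Submodule.fg_span_iff_fg_span_finset_subset _).mp
    (IsNoetherian.noetherian (Submodule.span ℂ S.positiveFunctionals))
  let g : V →ₗ[ℂ] ℂ := ∑ f ∈ t, f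
  have hg_apply : ∀ x, g x = ∑ f ∈ t, f x := fun x => LinearMap.sum_apply t _ x
  have hg_nonneg : ∀ x ∈ S.positives, 0 ≤ g x := fun x hx => by
    rw [hg_apply]
    exact Finset.sum_nonneg fun f hf => ht hf x hx
  have hg_faithful : ∀ x ∈ S.positives, g x = 0 → x = 0 := by
    intro x hx h
    rw [hg_apply, Finset.sum_eq_zero_iff_of_nonneg fun f hf => ht hf x hx] at h
    have hker : Submodule.span ℂ (t : Set (V →ₗ[ℂ] ℂ)) ≤ LinearMap.ker (LinearMap.applyₗ x) :=
      Submodule.span_le.mpr h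
    exact hsep x hx fun f hf => hker (hspan ▸ Submodule.subset_span hf)
  have hg_unit : g S.unit ≠ 0 := fun h => hunit (hg_faithful _ S.unit_mem_positives h)
  refine ⟨(g S.unit)⁻¹ • g, inv_mul_cancel₀ hg_unit, fun x hx => ?_, fun x hx h => ?_⟩
  · exact mul_nonneg (inv_nonneg.mpr (hg_nonneg _ S.unit_mem_positives)) (hg_nonneg x hx)
  · exact hg_faithful x hx ((mul_eq_zero_iff_left (inv_ne_zero hg_unit)).mp h)

end OperatorSystem

section DualEval

variable {V : Type*} [AddCommGroup V] [Module ℂ V] {n p : ℕ}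

/-- Evaluation of functionals at the entries of a fixed matrix `e`, as a map into `M_n`. -/
def dualEval (e : Matrix (Fin n) (Fin n) V) : DualSpace V →ₗ[ℂ] CStarMatrix (Fin n) (Fin n) ℂ where
  toFun f := CStarMatrix.ofMatrix (e.map f.ofConv)
  map_add' _ _ := rfl
  map_smul' _ _ := rfl

theorem dualEval_injective {e : Matrix (Fin n) (Fin n) V}
    (he : Submodule.span ℂ (Set.range fun ij : Fin n × Fin n => e ij.1 ij.2) = ⊤) :
    Function.Injective (dualEval e) := fun _ _ h =>
  WithConv.ofConv_injective (LinearMap.ext_on_range he fun ij => congrFun₂ h ij.1 ij.2)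

theorem map_dualEval_mem_cstarCone [StarAddMonoid V] [StarModule ℂ V] {S : OperatorSystem V}
    {e : Matrix (Fin n) (Fin n) V} (he : e ∈ S.cone n) {G : Matrix (Fin p) (Fin p) (DualSpace V)}
    (hG : G ∈ dualCone S p) :
    G.map (dualEval e) ∈ cstarCone (CStarMatrix (Fin n) (Fin n) ℂ) p :=
  (mem_cstarCone_matrix_iff _).mpr
    (((mem_cstarCone_matrix_iff _).mp (hG n e he)).submatrix Prod.swap)

end DualEval

section GramMatrix

variable {𝕜 ι E F : Type*} [RCLike 𝕜] [NormedAddCommGroup E] [InnerProductSpace 𝕜 E]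
  [NormedAddCommGroup F] [InnerProductSpace 𝕜 F]

open scoped MatrixOrder in
theorem exists_gram_eq_of_posSemidef {n : Type*} [Fintype n] {M : Matrix n n 𝕜}
    (hM : M.PosSemidef) : ∃ v : n → EuclideanSpace 𝕜 n, Matrix.gram 𝕜 v = M := by
  classical
  obtain ⟨B, rfl⟩ := CStarAlgebra.nonneg_iff_eq_star_mul_self.mp hM.nonneg
  refine ⟨fun j => WithLp.toLp 2 fun i => B i j, ?_⟩
  ext i j
  simp [Matrix.gram_apply, Matrix.mul_apply, PiLp.inner_apply, Matrix.star_eq_conjTranspose,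
    mul_comm]

theorem norm_linearCombination_eq_of_gram_eq {v : ι → E} {w : ι → F}
    (h : Matrix.gram 𝕜 v = Matrix.gram 𝕜 w) (c : ι →₀ 𝕜) :
    ‖Finsupp.linearCombination 𝕜 v c‖ = ‖Finsupp.linearCombination 𝕜 w c‖ := by
  have hinner : ∀ i j, inner 𝕜 (v i) (v j) = inner 𝕜 (w i) (w j) := congrFun₂ h
  simp only [@norm_eq_sqrt_re_inner 𝕜, Finsupp.linearCombination_apply, Finsupp.sum,
    sum_inner, inner_sum, inner_smul_left, inner_smul_right, hinner]

theorem exists_linearIsometry_range_of_gram_eq {v : ι → E} {w : ι → F}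
    (h : Matrix.gram 𝕜 v = Matrix.gram 𝕜 w) :
    ∃ T : LinearMap.range (Finsupp.linearCombination 𝕜 v) →ₗᵢ[𝕜] F,
      ∀ c, T ((Finsupp.linearCombination 𝕜 v).rangeRestrict c) =
        Finsupp.linearCombination 𝕜 w c := by
  let f := Finsupp.linearCombination 𝕜 v
  let g := Finsupp.linearCombination 𝕜 w
  obtain ⟨s, hs⟩ := f.rangeRestrict.exists_rightInverse_of_surjective f.range_rangeRestrict
  have hfs : ∀ y, f (s y) = y := fun y => congrArg Subtype.val (LinearMap.congr_fun hs y)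
  refine ⟨⟨g ∘ₗ s, fun y => ?_⟩, fun c => ?_⟩
  · exact (norm_linearCombination_eq_of_gram_eq h (s y)).symm.trans (congrArg norm (hfs y))
  · have hsub : ‖g (s (f.rangeRestrict c) - c)‖ = 0 := by
      rw [← norm_linearCombination_eq_of_gram_eq h, norm_eq_zero, map_sub, sub_eq_zero]
      exact hfs _
    rwa [norm_eq_zero, map_sub, sub_eq_zero] at hsub

theorem exists_linearIsometryEquiv_of_gram_eq [FiniteDimensional 𝕜 E] {v w : ι → E}
    (h : Matrix.gram 𝕜 v = Matrix.gram 𝕜 w) : ∃ U : E ≃ₗᵢ[𝕜] E, ∀ i, U (v i) = w i := by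
  obtain ⟨T, hT⟩ := exists_linearIsometry_range_of_gram_eq h
  refine ⟨T.extend.toLinearIsometryEquiv rfl, fun i => ?_⟩
  have hvi := (T.extend_apply _).trans (hT (Finsupp.single i 1))
  simpa using hvi

end GramMatrix

section MatrixCoefficient

variable {A H : Type*} [NormedAddCommGroup H] [InnerProductSpace ℂ H] [CompleteSpace H]

/-- The matrix coefficient `a ↦ ⟪ξ, π(a) η⟫` of a `*`-representation `π`. -/
noncomputable def matrixCoefficient [Semiring A] [Algebra ℂ A] [Star A]
    (π : A →⋆ₐ[ℂ] (H →L[ℂ] H)) (ξ η : H) : A →ₗ[ℂ] ℂ where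
  toFun a := inner ℂ ξ (π a η)
  map_add' a b := by rw [map_add, add_apply, inner_add_right]
  map_smul' c a := by
    rw [map_smul, smul_apply, inner_smul_right]
    rfl

theorem matrixCoefficient_star_mul [Semiring A] [Algebra ℂ A] [Star A]
    (π : A →⋆ₐ[ℂ] (H →L[ℂ] H)) (ξ η : H) (a b : A) :
    matrixCoefficient π ξ η (star a * b) = inner ℂ (π a ξ) (π b η) := by
  change inner ℂ ξ (π (star a * b) η) = _
  rw [map_mul, map_star, mul_apply_eq_comp, ContinuousLinearMap.star_eq_adjoint,
    ContinuousLinearMap.adjoint_inner_right]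

variable [CStarAlgebra A]

theorem sum_matrixCoefficient_nonneg (π : A →⋆ₐ[ℂ] (H →L[ℂ] H)) {p : ℕ} (ξ : Fin p → H)
    {x : Matrix (Fin p) (Fin p) A} (hx : x ∈ cstarCone A p) :
    0 ≤ ∑ k, ∑ l, matrixCoefficient π (ξ k) (ξ l) (x k l) := by
  obtain ⟨y, rfl⟩ := hx
  let η : Fin p → H := fun m => ∑ k, π (y m k) (ξ k)
  calc
    0 ≤ ∑ m, inner ℂ (η m) (η m) := Finset.sum_nonneg fun m _ => by
      rw [inner_self_eq_norm_sq_to_K]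
      exact pow_nonneg (Complex.zero_le_real.mpr (norm_nonneg (η m))) 2
    _ = ∑ m, ∑ l, ∑ k, inner ℂ (π (y m k) (ξ k)) (π (y m l) (ξ l)) := by
      simp only [η, sum_inner, inner_sum]
    _ = ∑ k, ∑ l, ∑ m, inner ℂ (π (y m k) (ξ k)) (π (y m l) (ξ l)) := by
      rw [Finset.sum_comm_cycle]
      exact Finset.sum_congr rfl fun _ _ => Finset.sum_comm
    _ = ∑ k, ∑ l, matrixCoefficient π (ξ k) (ξ l) ((yᴴ * y) k l) := by
      simp only [Matrix.mul_apply, Matrix.conjTranspose_apply, map_sum, matrixCoefficient_star_mul]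

/-- The matrix of restricted coefficients `s ↦ ⟪ξ_k, π(s) ξ_l⟫` over the dual of an operator
subsystem. -/
noncomputable def OperatorSubsystem.coefficientMatrix (U : OperatorSubsystem A)
    (π : A →⋆ₐ[ℂ] (H →L[ℂ] H)) {p : ℕ} (ξ : Fin p → H) : Matrix (Fin p) (Fin p) (DualSpace U) :=
  Matrix.of fun k l =>
    WithConv.toConv ((matrixCoefficient π (ξ k) (ξ l)).comp U.toSubmodule.subtype)

theorem OperatorSubsystem.coefficientMatrix_mem_dualCone (U : OperatorSubsystem A)
    (π : A →⋆ₐ[ℂ] (H →L[ℂ] H)) {p : ℕ} (ξ : Fin p → H) :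
    U.coefficientMatrix π ξ ∈ dualCone U.toOperatorSystem p :=
  (mem_dualCone_iff _ _).mpr fun _ hs => sum_matrixCoefficient_nonneg π ξ hs

theorem OperatorSubsystem.matrixCoefficient_mem_positiveFunctionals (U : OperatorSubsystem A)
    (π : A →⋆ₐ[ℂ] (H →L[ℂ] H)) (ξ : H) :
    (matrixCoefficient π ξ ξ).comp U.toSubmodule.subtype ∈
      U.toOperatorSystem.positiveFunctionals := fun x hx => by
  have h := sum_matrixCoefficient_nonneg π (fun _ : Fin 1 => ξ) hx
  rwa [Fin.sum_univ_one, Fin.sum_univ_one] at h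

end MatrixCoefficient

section GroupCStarAlgebra

variable {G : Type} [Group G]

/-- The extension of a unitary representation of `G` to `C*(G)`. -/
def FullGroupCStarAlgebra.rep (ρ : UnitaryRepresentation G) :
    FullGroupCStarAlgebra G →⋆ₐ[ℂ] (ρ.H →L[ℂ] ρ.H) where
  toFun a := (Subtype.val a : BoundedFamilies G) ρ
  map_one' := rfl
  map_mul' _ _ := rfl
  map_zero' := rfl
  map_add' _ _ := rfl
  commutes' _ := rfl
  map_star' _ := rfl

theorem FullGroupCStarAlgebra.rep_of (ρ : UnitaryRepresentation G) (g : G) :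
    rep ρ (of g) = ρ.π g := rfl

theorem FullGroupCStarAlgebra.ext_rep {a b : FullGroupCStarAlgebra G}
    (h : ∀ ρ, rep ρ a = rep ρ b) : a = b :=
  Subtype.ext (Subtype.ext (funext h))

theorem FullGroupCStarAlgebra.of_mem_unitary (g : G) :
    of g ∈ unitary (FullGroupCStarAlgebra G) := by
  constructor <;> refine ext_rep fun ρ => ?_ <;> rw [map_mul, map_star, rep_of, map_one]
  · exact Unitary.coe_star_mul_self (ρ.π g)
  · exact Unitary.coe_mul_star_self (ρ.π g)

instance FullGroupCStarAlgebra.instNontrivial : Nontrivial (FullGroupCStarAlgebra G) := by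
  let trivialRep : UnitaryRepresentation G := { H := ℂ, π := 1 }
  exact (rep trivialRep).toRingHom.domain_nontrivial

theorem FullGroupCStarAlgebra.exists_isFaithfulState
    (U : OperatorSubsystem (FullGroupCStarAlgebra G)) [FiniteDimensional ℂ U] :
    ∃ δ : U →ₗ[ℂ] ℂ, IsFaithfulState U.toOperatorSystem δ := by
  refine U.toOperatorSystem.exists_isFaithfulState
    (fun h => one_ne_zero (congrArg Subtype.val h)) fun x _ hx => ?_
  refine Subtype.ext (ext_rep fun ρ => ?_)
  have hquad : ∀ ξ, inner ℂ (rep ρ x ξ) ξ = 0 := fun ξ =>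
    inner_eq_zero_symm.mp (hx _ (U.matrixCoefficient_mem_positiveFunctionals (rep ρ) ξ))
  have hrep : (rep ρ x : ρ.H →ₗ[ℂ] ρ.H) = 0 := (inner_map_self_eq_zero _).mp hquad
  exact (ContinuousLinearMap.coe_injective hrep).trans (map_zero (rep ρ)).symm

end GroupCStarAlgebra

section FreeUnitary

variable {n : ℕ}

theorem freeUnitary_mem_unitary (i : Fin n) : freeUnitary n i ∈ unitary _ := by
  unfold freeUnitary
  split_ifs
  · exact one_mem _
  · exact FullGroupCStarAlgebra.of_mem_unitary _

variable {H : Type} [NormedAddCommGroup H] [InnerProductSpace ℂ H] [CompleteSpace H] [Nontrivial H]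

/-- The representation of `F_{n-1}` in which `w_i` acts as `T i` for `i ≠ 0`; the value `T 0` is
ignored. -/
noncomputable abbrev freeRepresentation (T : Fin n → unitary (H →L[ℂ] H)) :
    UnitaryRepresentation (FreeGroup (Fin (n - 1))) where
  H := H
  π := FreeGroup.lift fun m => T ⟨m + 1, by omega⟩

theorem rep_freeRepresentation_freeUnitary (T : Fin n → unitary (H →L[ℂ] H)) (i : Fin n) :
    FullGroupCStarAlgebra.rep (freeRepresentation T) (freeUnitary n i) =
      if (i : ℕ) = 0 then 1 else (T i : H →L[ℂ] H) := by
  unfold freeUnitary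
  split_ifs with hi
  · exact map_one _
  · rw [FullGroupCStarAlgebra.rep_of]
    refine congrArg Subtype.val (FreeGroup.lift_apply_of.trans (congrArg T (Fin.ext ?_)))
    exact Nat.succ_pred_eq_of_ne_zero hi

theorem exists_rep_star_freeUnitary_apply [FiniteDimensional ℂ H] [NeZero n] {κ : Type*}
    (v : κ → Fin n → H)
    (h : ∀ i, Matrix.gram ℂ (fun k => v k i) = Matrix.gram ℂ (fun k => v k 0)) :
    ∃ T : Fin n → unitary (H →L[ℂ] H), ∀ k i,
      FullGroupCStarAlgebra.rep (freeRepresentation T) (star (freeUnitary n i)) (v k 0) =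
        v k i := by
  choose U hU using fun i => exists_linearIsometryEquiv_of_gram_eq (h i)
  refine ⟨fun i => Unitary.linearIsometryEquiv.symm (U i), fun k i => ?_⟩
  rw [map_star, rep_freeRepresentation_freeUnitary]
  split_ifs with hi
  · rw [star_one, show i = 0 from Fin.ext hi]
    rfl
  · rw [← hU i k]
    exact DFunLike.congr_fun
      (Unitary.coe_star_mul_self (Unitary.linearIsometryEquiv.symm (U i))) (v k i)

theorem exists_matrixCoefficient_freeUnitary_eq_inner [FiniteDimensional ℂ H] [NeZero n]
    {κ : Type*} (v : κ → Fin n → H)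
    (h : ∀ i, Matrix.gram ℂ (fun k => v k i) = Matrix.gram ℂ (fun k => v k 0)) :
    ∃ (ρ : UnitaryRepresentation (FreeGroup (Fin (n - 1)))) (ξ : κ → ρ.H), ∀ k l i j,
      matrixCoefficient (FullGroupCStarAlgebra.rep ρ) (ξ k) (ξ l)
        (freeUnitary n i * star (freeUnitary n j)) = inner ℂ (v k i) (v l j) := by
  obtain ⟨T, hT⟩ := exists_rep_star_freeUnitary_apply v h
  refine ⟨freeRepresentation T, fun k => v k 0, fun k l i j => ?_⟩
  rw [← star_star (freeUnitary n i), matrixCoefficient_star_mul, hT, hT]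

end FreeUnitary

section DualOfOSW

variable {n : ℕ} (hn : 2 ≤ n)

/-- The matrix `[w_i w_j*]` over `W_n`. -/
noncomputable def OSW.unitaryMatrix : Matrix (Fin n) (Fin n) (OSW n hn) :=
  Matrix.of fun i j =>
    ⟨freeUnitary n i * star (freeUnitary n j), Submodule.subset_span ⟨(i, j), rfl⟩⟩

theorem OSW.unitaryMatrix_self (i : Fin n) :
    unitaryMatrix hn i i = (OSW n hn).toOperatorSystem.unit :=
  Subtype.ext (Unitary.mul_star_self_of_mem (freeUnitary_mem_unitary i))

theorem OSW.span_range_unitaryMatrix :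
    Submodule.span ℂ (Set.range fun ij : Fin n × Fin n => unitaryMatrix hn ij.1 ij.2) = ⊤ :=
  (Submodule.span_range_subtype_eq_top_iff (OSW n hn).toSubmodule _).mpr rfl

theorem OSW.unitaryMatrix_mem_cone : unitaryMatrix hn ∈ (OSW n hn).toOperatorSystem.cone n := by
  let row : Matrix (Fin 1) (Fin n) (FullGroupCStarAlgebra (FreeGroup (Fin (n - 1)))) :=
    Matrix.of fun _ j => star (freeUnitary n j)
  refine (congrArg (· ∈ cstarCone _ n) ?_).mpr (cstarCone_gram_mem row)
  ext i j
  simp [row, Matrix.mul_apply, unitaryMatrix]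

/-- The map `f ↦ [f(w_i w_j*)]` from `W_n^d` to `E_n`. -/
noncomputable def dualToOSE : DualSpace (OSW n hn) →ₗ[ℂ] OSE n :=
  (dualEval (OSW.unitaryMatrix hn)).codRestrict (OSE n).toSubmodule fun f i j =>
    congrArg f.ofConv ((OSW.unitaryMatrix_self hn i).trans (OSW.unitaryMatrix_self hn j).symm)

theorem dualToOSE_injective : Function.Injective (dualToOSE hn) := fun _ _ h =>
  dualEval_injective (OSW.span_range_unitaryMatrix hn) (congrArg Subtype.val h)

theorem isCompletelyPositive_dualToOSE {δ : OSW n hn →ₗ[ℂ] ℂ}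
    (hδ : IsFaithfulState (OSW n hn).toOperatorSystem δ) :
    IsCompletelyPositive ((OSW n hn).toOperatorSystem.dual δ hδ) (OSE n).toOperatorSystem
      (dualToOSE hn) :=
  fun _ _ hG => map_dualEval_mem_cstarCone (OSW.unitaryMatrix_mem_cone hn) hG

theorem exists_inner_eq_of_mem_OSE_cone {p : ℕ} {x : Matrix (Fin p) (Fin p) (OSE n)}
    (hx : x ∈ (OSE n).toOperatorSystem.cone p) :
    ∃ v : Fin p → Fin n → EuclideanSpace ℂ (Fin p × Fin n), ∀ k l i j,
      inner ℂ (v k i) (v l j) = (x k l : CStarMatrix (Fin n) (Fin n) ℂ) i j := by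
  obtain ⟨v, hv⟩ := exists_gram_eq_of_posSemidef ((mem_cstarCone_matrix_iff _).mp hx)
  exact ⟨fun k i => v (k, i), fun k l i j => congrFun₂ hv (k, i) (l, j)⟩

theorem exists_mem_dualCone_map_dualToOSE_eq {p : ℕ} {x : Matrix (Fin p) (Fin p) (OSE n)}
    (hx : x ∈ (OSE n).toOperatorSystem.cone p) :
    ∃ G ∈ dualCone (OSW n hn).toOperatorSystem p, G.map (dualToOSE hn) = x := by
  have : NeZero n := ⟨by omega⟩
  rcases Nat.eq_zero_or_pos p with rfl | hp
  · exact ⟨0, (mem_dualCone_iff _ _).mpr fun x _ => by simp [dualPairing_apply],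
      Subsingleton.elim _ _⟩
  have : NeZero p := ⟨hp.ne'⟩
  obtain ⟨v, hv⟩ := exists_inner_eq_of_mem_OSE_cone hx
  obtain ⟨ρ, ξ, hρ⟩ := exists_matrixCoefficient_freeUnitary_eq_inner v fun i => by
    ext k l
    rw [Matrix.gram_apply, Matrix.gram_apply, hv, hv]
    exact (x k l).2 i 0
  refine ⟨_, (OSW n hn).coefficientMatrix_mem_dualCone (FullGroupCStarAlgebra.rep ρ) ξ, ?_⟩
  ext1 k l
  exact Subtype.ext (CStarMatrix.ext fun i j => (hρ k l i j).trans (hv k l i j))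

end DualOfOSW

theorem mainTheorem11 (n : ℕ) (hn : 2 ≤ n) :
    (∃ δ : OSW n hn →ₗ[ℂ] ℂ, IsFaithfulState (OSW n hn).toOperatorSystem δ) ∧
    ∀ (δ : OSW n hn →ₗ[ℂ] ℂ) (hδ : IsFaithfulState (OSW n hn).toOperatorSystem δ),
      CompletelyOrderIsomorphic ((OSW n hn).toOperatorSystem.dual δ hδ) (OSE n).toOperatorSystem :=
  ⟨FullGroupCStarAlgebra.exists_isFaithfulState (OSW n hn), fun _ hδ =>
    completelyOrderIsomorphic_of_exists_lift (dualToOSE hn) (dualToOSE_injective hn)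
      (isCompletelyPositive_dualToOSE hn hδ) fun _ _ hy =>
        exists_mem_dualCone_map_dualToOSE_eq hn hy⟩
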